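/- A polytope $P\subseteq\mathbb R^n$ (the convex hull of a finite set of points) is called \emph{2-level} if every hyperplane $H$ that is facet-defining for $P$ has a parallel hyperplane $H'$ containing all vertices of $P$ that are not contained in $H$. A vertex of a $d$-dimensional polytope is \emph{simple} if it is contained in exactly $d$ facets. The \emph{stable set polytope} of a finite graph $G=(V,E)$ is the convex hull in $\mathbb R^V$ of the characteristic vectors of the stable (independent) sets of $G$, and $G$ is \emph{perfect} if every induced subgraph of $G$ has chromatic number equal to its clique number. Two polytopes $P\subseteq\mathbb R^n$ and $Q\subseteq\mathbb R^m$ are \emph{affinely isomorphic} if some affine map $\mathbb R^n\to\mathbb R^m$ restricts to a bijection from $P$ onto $Q$. If a 2-level polytope has a simple vertex, then it is affinely isomorphic to the stable set polytope of a perfect graph. -/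

import Mathlib

/-- A convex polytope: the convex hull of a finite (possibly empty) set of points. -/
def IsPolytope {E : Type*} [AddCommGroup E] [Module ℝ E] (P : Set E) : Prop :=
  ∃ S : Set E, S.Finite ∧ P = convexHull ℝ S

/-- The dimension of the affine hull of `P` (with the value `0` for the empty set). -/
noncomputable def polyDim {E : Type*} [AddCommGroup E] [Module ℝ E] (P : Set E) : ℕ :=
  Module.finrank ℝ (vectorSpan ℝ P)

/-- The hyperplane `{x | g x = c}` is facet-defining for `P`: the inequality `g x ≤ c` is valid
for `P`, and the face `P ∩ {x | g x = c}` is nonempty and of dimension `dim P - 1`.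
(This forces `g ≠ 0`, since for `g = 0` that face is `∅` or `P`.) -/
def IsFacetDefining {E : Type*} [AddCommGroup E] [Module ℝ E] (P : Set E)
    (g : Module.Dual ℝ E) (c : ℝ) : Prop :=
  (∀ x ∈ P, g x ≤ c) ∧ (P ∩ {x | g x = c}).Nonempty ∧
    polyDim (P ∩ {x | g x = c}) + 1 = polyDim P

/-- `F` is a facet of `P`. -/
def IsFacet {E : Type*} [AddCommGroup E] [Module ℝ E] (P F : Set E) : Prop :=
  ∃ (g : Module.Dual ℝ E) (c : ℝ), IsFacetDefining P g c ∧ F = P ∩ {x | g x = c}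

/-- `P` is a 2-level polytope: for every facet-defining hyperplane `{x | g x = c}` there is a
parallel hyperplane `{x | g x = c'}` containing all vertices (extreme points) of `P` that are not
on `{x | g x = c}`. -/
def IsTwoLevel {E : Type*} [AddCommGroup E] [Module ℝ E] (P : Set E) : Prop :=
  IsPolytope P ∧ ∀ (g : Module.Dual ℝ E) (c : ℝ), IsFacetDefining P g c →
    ∃ c' : ℝ, ∀ v ∈ P.extremePoints ℝ, g v ≠ c → g v = c'

/-- `v` is a simple vertex of the `d`-dimensional polytope `P`: a vertex contained in exactly
`d` facets. -/
def IsSimpleVertex {E : Type*} [AddCommGroup E] [Module ℝ E] (P : Set E) (v : E) : Prop :=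
  v ∈ P.extremePoints ℝ ∧ {F : Set E | IsFacet P F ∧ v ∈ F}.encard = polyDim P

/-- `P` and `Q` are affinely isomorphic: some affine map between the ambient spaces restricts to
a bijection from `P` onto `Q`. -/
def AffinelyIsomorphic {E F : Type*} [AddCommGroup E] [Module ℝ E] [AddCommGroup F] [Module ℝ F]
    (P : Set E) (Q : Set F) : Prop :=
  ∃ f : E →ᵃ[ℝ] F, Set.BijOn f P Q

/-- The stable set polytope of `G`: the convex hull of the characteristic vectors of the stable
(independent) sets of `G`. -/
def stableSetPolytope {V : Type*} (G : SimpleGraph V) : Set (V → ℝ) :=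
  convexHull ℝ {x | ∃ S : Set V, G.IsIndepSet S ∧ x = S.indicator (fun _ => (1 : ℝ))}

/-- A finite graph is perfect if the chromatic number of each induced subgraph equals the
maximum size of a clique of that subgraph. -/
def IsPerfectGraph {V : Type*} [Fintype V] (G : SimpleGraph V) : Prop :=
  ∀ s : Set V, (G.induce s).chromaticNumber = ((G.induce s).cliqueNum : ℕ∞)

/-!
Let `P` be a 2-level polytope of dimension `d` with a simple vertex `v`.

*Coordinates.* In its affine hull, `P` is the intersection of its facet half-spaces
(`exists_isFacetDefining_of_notMem`): the polar body about an interior point is compact, so by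
Krein–Milman every point outside `P` is cut off by an extreme point of the polar, and extreme points
of the polar are facets. By 2-levelness each facet inequality can be scaled to a slack function
`φ ≥ 0` that is `0` or `1` at every vertex (`IsFacetSlack`). Such a function is determined on the
affine hull by its facet, and the slacks vanishing at `v` cut out the tangent cone at `v`. Since `v`
is extreme, the `d` facets through `v` have slacks whose linear parts jointly separate directions, so
these slacks are coordinates in which `v = 0`, the tangent cone is the nonnegative orthant and all
vertices are `0/1` vectors. In particular the edge along a coordinate axis ends at a unit vector
(`IsSimpleVertex.exists_dual_basis`).

*The graph.* Each remaining facet inequality reads `∑ aᵢ xᵢ ≤ 1`, and evaluating at the unit vectors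
shows `aᵢ ∈ {0, 1}`. So `P` becomes `{x ≥ 0 | ∑_{i ∈ C} xᵢ ≤ 1 for all rows C}` with `0/1` vertices.
Join `i` and `j` when the sum of their unit vectors lies outside `P`, that is, when they share a row
(`conflictGraph`). Rows are then cliques and the `0/1` points of `P` are exactly the stable sets, so
`P` is the stable set polytope of this graph.

*Perfection.* If every clique inside `H` has at most `k` vertices, the weighting `1 / k` on `H`
satisfies all row inequalities, so it is a convex combination of stable sets. Each of these is
contained in `H` and meets every `k`-clique of `H` (`exists_isIndepSet_hitting`); removing one of them
lowers the clique bound, and induction on `k` colors `H` with `k` colors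
(`isPerfectGraph_of_indicator_mem`).
-/

open Set Module

/-! ### Facets violated by an outside point -/

theorem polyDim_image_of_injective {E F : Type*} [AddCommGroup E] [Module ℝ E]
    [AddCommGroup F] [Module ℝ F] (f : E →ᵃ[ℝ] F) (hf : Function.Injective f) (s : Set E) :
    polyDim (f '' s) = polyDim s := by
  unfold polyDim
  rw [← f.map_vectorSpan]
  exact LinearEquiv.finrank_eq
    (Submodule.equivMapOfInjective _ (f.linear_injective_iff.2 hf) _).symm

/-- At an extreme point `f` of the polar of `S` about `p`, the vectors `t - p` with `f (t - p) = 1`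
span: otherwise `f` could be moved both ways along a functional vanishing on all of them. -/
theorem span_tight_eq_top_of_mem_extremePoints {W : Type*} [NormedAddCommGroup W]
    [NormedSpace ℝ W] [FiniteDimensional ℝ W] {S : Set W} (hS : S.Finite) {p : W}
    {f : W →L[ℝ] ℝ} (hf : f ∈ {f : W →L[ℝ] ℝ | ∀ t ∈ S, f (t - p) ≤ 1}.extremePoints ℝ) :
    Submodule.span ℝ ((fun t => t - p) '' {t ∈ S | f (t - p) = 1}) = ⊤ := by
  by_contra hne
  obtain ⟨h, h0, hle⟩ := Submodule.exists_le_ker_of_lt_top _ (lt_top_iff_ne_top.2 hne)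
  have hker : ∀ t ∈ S, f (t - p) = 1 → h (t - p) = 0 := fun t ht h1 =>
    hle (Submodule.subset_span ⟨t, ⟨ht, h1⟩, rfl⟩)
  have hev : ∀ᶠ ε : ℝ in nhdsWithin 0 (Ioi 0), ∀ t ∈ S,
      f (t - p) + ε * h (t - p) ≤ 1 ∧ f (t - p) - ε * h (t - p) ≤ 1 := by
    rw [Filter.eventually_all_finite hS]
    intro t ht
    rcases (hf.1 t ht).eq_or_lt with h1 | h1
    · simp [hker t ht h1, h1]
    · have c1 : ContinuousAt (fun ε : ℝ => f (t - p) + ε * h (t - p)) 0 := by fun_prop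
      have c2 : ContinuousAt (fun ε : ℝ => f (t - p) - ε * h (t - p)) 0 := by fun_prop
      refine Filter.Eventually.filter_mono nhdsWithin_le_nhds ?_
      filter_upwards [c1.eventually_lt_const (by simpa using h1),
        c2.eventually_lt_const (by simpa using h1)] with ε e1 e2
      exact ⟨e1.le, e2.le⟩
  obtain ⟨ε, hε, hpos⟩ := (hev.and self_mem_nhdsWithin).exists
  replace hpos : 0 < ε := hpos
  set h' : W →L[ℝ] ℝ := LinearMap.toContinuousLinearMap h with hh'
  have key := (mem_extremePoints_iff_left.1 hf).2 (f + ε • h') (fun t ht => by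
    simpa [hh'] using (hε t ht).1) (f - ε • h') (fun t ht => by
    simpa [hh'] using (hε t ht).2) ⟨1 / 2, 1 / 2, by norm_num, by norm_num, by norm_num, by module⟩
  apply h0
  ext w
  have := congrArg (fun k : W →L[ℝ] ℝ => k w) key
  simpa [hh', hpos.ne'] using this

/-- A point outside a full-dimensional polytope violates a facet-defining inequality. Around an
interior point `p`, the polar body is compact, so by Krein–Milman a violated valid inequality can
be taken to be an extreme point of the polar, and such an extreme point defines a facet. -/
theorem exists_isFacetDefining_of_affineSpan_eq_top {W : Type*} [NormedAddCommGroup W]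
    [NormedSpace ℝ W] [FiniteDimensional ℝ W] {S : Set W} (hS : S.Finite)
    (hspan : affineSpan ℝ S = ⊤) {x : W} (hx : x ∉ convexHull ℝ S) :
    ∃ (g : Dual ℝ W) (c : ℝ), IsFacetDefining (convexHull ℝ S) g c ∧ c < g x := by
  obtain ⟨p, hp⟩ := interior_convexHull_nonempty_iff_affineSpan_eq_top.2 hspan
  set K : Set (W →L[ℝ] ℝ) := {f | ∀ t ∈ S, f (t - p) ≤ 1} with hK
  have hvalid : ∀ f ∈ K, ∀ y ∈ convexHull ℝ S, f (y - p) ≤ 1 := by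
    intro f hf y hy
    have : f y ≤ 1 + f p :=
      convexHull_min (t := {y | f y ≤ 1 + f p})
        (fun t ht => by have := hf t ht; rw [map_sub] at this; simp only [mem_ofPred_eq]; linarith)
        (convex_halfSpace_le f.toLinearMap.isLinear _) hy
    rw [map_sub]; linarith
  have hKclosed : IsClosed K := by
    have : K = ⋂ t ∈ S, {f : W →L[ℝ] ℝ | f (t - p) ≤ 1} := by ext; simp [hK]
    rw [this]
    exact isClosed_biInter fun t _ => isClosed_le (by fun_prop) continuous_const
  have hKbdd : Bornology.IsBounded K := by
    obtain ⟨r, hr, hball⟩ := Metric.isOpen_iff.1 isOpen_interior p hp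
    refine (NormedSpace.isBounded_polar_of_mem_nhds_zero ℝ (Metric.ball_mem_nhds (0 : W) hr)).subset
      fun f hf u hu => ?_
    have mem : ∀ u : W, ‖u‖ < r → f u ≤ 1 := fun u hu => by
      have := hvalid f hf (p + u) (interior_subset (hball (by simpa using hu)))
      simpa using this
    rw [mem_ball_zero_iff] at hu
    have h1 := mem u hu
    have h2 := mem (-u) (by simpa using hu)
    rw [map_neg] at h2
    have h3 : -1 ≤ f u := by linarith
    exact abs_le.2 ⟨h3, h1⟩
  have hKcomp : IsCompact K := Metric.isCompact_of_isClosed_isBounded hKclosed hKbdd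
  have hKconv : Convex ℝ K := by
    intro f hf k hk a b ha hb hab t ht
    have h1 := hf t ht
    have h2 := hk t ht
    simp only [add_apply, smul_apply, smul_eq_mul]
    nlinarith
  obtain ⟨f₀, hf₀K, hf₀x⟩ : ∃ f ∈ K, 1 < f (x - p) := by
    obtain ⟨f, u, h1, h2⟩ := geometric_hahn_banach_closed_point (convex_convexHull ℝ S)
      (hS.isCompact_convexHull ℝ).isClosed hx
    have hup : 0 < u - f p := sub_pos.2 (h1 p (interior_subset hp))
    refine ⟨(u - f p)⁻¹ • f, fun t ht => ?_, ?_⟩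
    · have := h1 t (subset_convexHull ℝ S ht)
      rw [smul_apply, smul_eq_mul, inv_mul_le_iff₀ hup, map_sub]; linarith
    · rw [smul_apply, smul_eq_mul, lt_inv_mul_iff₀ hup, map_sub]; linarith
  obtain ⟨f, hf, hfx⟩ : ∃ f ∈ K.extremePoints ℝ, 1 < f (x - p) := by
    by_contra! hcon
    have hsub : closure (convexHull ℝ (K.extremePoints ℝ)) ⊆ {f | f (x - p) ≤ 1} := by
      refine closure_minimal (convexHull_min hcon ?_) (isClosed_le (by fun_prop) continuous_const)
      intro f hf k hk a b ha hb hab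
      simp only [mem_ofPred_eq, add_apply, smul_apply,
        smul_eq_mul] at hf hk ⊢
      nlinarith
    rw [closure_convexHull_extremePoints hKcomp hKconv] at hsub
    exact absurd (hsub hf₀K) (not_le.2 hf₀x)
  have hsp := span_tight_eq_top_of_mem_extremePoints hS hf
  set T := {t ∈ S | f (t - p) = 1} with hT
  have hf0 : f.toLinearMap ≠ 0 := by
    intro h
    have : f (x - p) = 0 := by rw [← ContinuousLinearMap.coe_coe, h]; rfl
    linarith
  obtain ⟨t₀, ht₀⟩ : T.Nonempty := by
    by_contra hem
    rw [not_nonempty_iff_eq_empty] at hem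
    rw [hem, image_empty, Submodule.span_empty] at hsp
    have : x - p ∈ (⊥ : Submodule ℝ W) := hsp ▸ Submodule.mem_top
    rw [(Submodule.mem_bot ℝ).1 this, map_zero] at hfx
    linarith
  have hface : T ⊆ convexHull ℝ S ∩ {x | f.toLinearMap x = 1 + f p} := fun t ht => by
    refine ⟨subset_convexHull ℝ S ht.1, ?_⟩
    have := ht.2
    rw [map_sub] at this
    simp only [mem_ofPred_eq, ContinuousLinearMap.coe_coe]; linarith
  refine ⟨f.toLinearMap, 1 + f p, ⟨fun y hy => ?_, ⟨t₀, hface ht₀⟩, ?_⟩, ?_⟩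
  · have := hvalid f hf.1 y hy
    rw [map_sub] at this
    simp only [ContinuousLinearMap.coe_coe]; linarith
  · have hdim : vectorSpan ℝ (convexHull ℝ S) = ⊤ := by
      rw [← direction_affineSpan, affineSpan_convexHull, hspan, AffineSubspace.direction_top]
    have hrank := Module.Dual.finrank_ker_add_one_of_ne_zero (K := ℝ) hf0
    unfold polyDim
    rw [hdim, finrank_top, ← hrank]
    congr 1
    apply le_antisymm
    · apply Submodule.finrank_mono
      rw [vectorSpan_def, Submodule.span_le]
      rintro _ ⟨a, ha, b, hb, rfl⟩
      have h1 : f a = _ := ha.2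
      have h2 : f b = _ := hb.2
      simp [h1, h2]
    · have h1 : (⊤ : Submodule ℝ W) ≤ vectorSpan ℝ T ⊔ Submodule.span ℝ {t₀ - p} := by
        rw [← hsp, Submodule.span_le]
        rintro _ ⟨t, ht, rfl⟩
        have : t - p = (t -ᵥ t₀) + (t₀ - p) := by rw [vsub_eq_sub]; abel
        simp only [SetLike.mem_coe]
        rw [this]
        exact Submodule.add_mem_sup (vsub_mem_vectorSpan ℝ ht ht₀)
          (Submodule.mem_span_singleton_self _)
      have h2 := (Submodule.finrank_mono h1).trans (Submodule.finrank_add_le_finrank_add_finrank _ _)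
      have h3 : finrank ℝ (Submodule.span ℝ {t₀ - p}) ≤ 1 := by
        simpa using finrank_span_le_card (R := ℝ) ({t₀ - p} : Set W)
      have h4 := Submodule.finrank_mono (vectorSpan_mono ℝ hface)
      rw [finrank_top] at h2
      omega
  · rw [map_sub] at hfx
    simp only [ContinuousLinearMap.coe_coe]; linarith

/-- A point of the affine hull of a polytope that lies outside the polytope violates a
facet-defining inequality. -/
theorem exists_isFacetDefining_of_notMem {E : Type*} [NormedAddCommGroup E]
    [NormedSpace ℝ E] [FiniteDimensional ℝ E] {S : Set E} (hS : S.Finite) {v : E} (hv : v ∈ S)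
    {u : E} (hu : u ∈ vectorSpan ℝ S) (hx : v + u ∉ convexHull ℝ S) :
    ∃ (g : Dual ℝ E) (c : ℝ), IsFacetDefining (convexHull ℝ S) g c ∧ c < g (v + u) := by
  set W := vectorSpan ℝ S with hW
  let j : W →ᵃ[ℝ] E := AffineMap.const ℝ W v + W.subtype.toAffineMap
  have hj : ∀ w : W, j w = v + w := fun w => rfl
  have hjlin : j.linear = W.subtype := by ext w; simp [j]
  have hjinj : Function.Injective j := fun a b h => by
    simpa [hj] using h
  have hTS : j '' (j ⁻¹' S) = S := by
    rw [image_preimage_eq_iff]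
    intro s hs
    exact ⟨⟨s - v, vsub_mem_vectorSpan ℝ hs hv⟩, by simp [hj]⟩
  have hne : (j ⁻¹' S).Nonempty := ⟨0, by simpa [hj] using hv⟩
  have hvs : vectorSpan ℝ (j ⁻¹' S) = ⊤ := by
    have h1 := j.map_vectorSpan (s := j ⁻¹' S)
    rw [hTS, hjlin] at h1
    rw [eq_top_iff]
    intro w _
    have : (w : E) ∈ Submodule.map W.subtype (vectorSpan ℝ (j ⁻¹' S)) := by rw [h1]; exact w.2
    simpa using this
  have hconv : convexHull ℝ S = j '' convexHull ℝ (j ⁻¹' S) := by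
    rw [j.image_convexHull, hTS]
  obtain ⟨g₀, c₀, ⟨hval, hnon, hdim⟩, hlt⟩ := exists_isFacetDefining_of_affineSpan_eq_top
    (hS.preimage hjinj.injOn)
    ((AffineSubspace.affineSpan_eq_top_iff_vectorSpan_eq_top_of_nonempty ℝ W W hne).2 hvs)
    (x := ⟨u, hu⟩) (fun h => hx (by rw [hconv]; exact ⟨_, h, rfl⟩))
  obtain ⟨g, hg⟩ := LinearMap.exists_extend g₀
  have hgj : ∀ w : W, g (j w) = g v + g₀ w := fun w => by
    rw [hj, map_add, ← hg]; rfl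
  have hF : convexHull ℝ S ∩ {x | g x = g v + c₀} =
      j '' (convexHull ℝ (j ⁻¹' S) ∩ {x | g₀ x = c₀}) := by
    rw [hconv]
    ext x
    constructor
    · rintro ⟨⟨w, hw, rfl⟩, h⟩
      exact ⟨w, ⟨hw, by simpa [hgj] using h⟩, rfl⟩
    · rintro ⟨w, ⟨hw, h⟩, rfl⟩
      exact ⟨⟨w, hw, rfl⟩, by simpa [hgj] using h⟩
  refine ⟨g, g v + c₀, ⟨?_, ?_, ?_⟩, ?_⟩
  · rw [hconv]
    rintro _ ⟨w, hw, rfl⟩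
    rw [hgj]; linarith [hval w hw]
  · rw [hF]; exact hnon.image _
  · rw [hF, hconv, polyDim_image_of_injective j hjinj, polyDim_image_of_injective j hjinj, hdim]
  · rw [show v + u = j ⟨u, hu⟩ from rfl, hgj]; linarith

/-! ### Convex combinations on a face -/

/-- Affine functions that are nonnegative on `A` and vanish at a point of the convex hull vanish
on all points of `A` that contribute to that point. -/
theorem mem_convexHull_sep_eq_zero {E : Type*} [AddCommGroup E] [Module ℝ E] {A : Set E} {x : E}
    (hx : x ∈ convexHull ℝ A) (Λ : Set (E →ᵃ[ℝ] ℝ)) (hnn : ∀ l ∈ Λ, ∀ a ∈ A, 0 ≤ l a)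
    (hz : ∀ l ∈ Λ, l x = 0) : x ∈ convexHull ℝ {a ∈ A | ∀ l ∈ Λ, l a = 0} := by
  classical
  rw [convexHull_eq] at hx
  obtain ⟨ι, t, w, z, hw0, hw1, hzA, rfl⟩ := hx
  rw [← Finset.centerMass_filter_ne_zero]
  refine Finset.centerMass_mem_convexHull _ (fun i hi => hw0 i (Finset.mem_filter.1 hi).1)
    (by rw [Finset.sum_filter_ne_zero, hw1]; exact one_pos) (fun i hi => ?_)
  obtain ⟨hit, hwi⟩ := Finset.mem_filter.1 hi
  refine ⟨hzA i hit, fun l hl => ?_⟩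
  have hsum : ∑ i ∈ t, w i * l (z i) = 0 := by
    have h := hz l hl
    rw [← affineCombination_eq_centerMass hw1, Finset.map_affineCombination _ _ _ hw1,
      Finset.affineCombination_eq_linear_combination _ _ _ hw1] at h
    simpa using h
  have := (Finset.sum_eq_zero_iff_of_nonneg fun i hi =>
    mul_nonneg (hw0 i hi) (hnn l hl _ (hzA i hi))).1 hsum i hit
  exact (mul_eq_zero.1 this).resolve_left hwi

/-! ### A polyhedral criterion for perfection -/

/-- If `1_H / k` is a convex combination of stable sets, where every clique in `H` has at most `k`
vertices, then each stable set of the combination lies in `H` and meets all `k`-cliques of `H`. -/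
theorem exists_isIndepSet_hitting {V : Type*} [Fintype V] {G : SimpleGraph V} {H : Finset V}
    {k : ℕ} (hk : 0 < k)
    (hmem : (H : Set V).indicator (fun _ => (k : ℝ)⁻¹) ∈ stableSetPolytope G) :
    ∃ S : Set V, G.IsIndepSet S ∧ S ⊆ H ∧
      ∀ C ⊆ H, G.IsClique (C : Set V) → C.card = k → ∃ i ∈ C, i ∈ S := by
  classical
  let proj : V → ((V → ℝ) →ᵃ[ℝ] ℝ) := fun i => (LinearMap.proj i : (V → ℝ) →ₗ[ℝ] ℝ).toAffineMap
  let Λ₁ : Set ((V → ℝ) →ᵃ[ℝ] ℝ) := {l | ∃ i ∉ H, l = proj i}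
  let Λ₂ : Set ((V → ℝ) →ᵃ[ℝ] ℝ) := {l | ∃ C ⊆ H, G.IsClique (C : Set V) ∧ C.card = k ∧
    l = AffineMap.const ℝ _ 1 - ∑ i ∈ C, proj i}
  have happ : ∀ (C : Finset V) (x : V → ℝ),
      (AffineMap.const ℝ (V → ℝ) (1 : ℝ) - ∑ i ∈ C, proj i) x = 1 - ∑ i ∈ C, x i := by
    intro C x
    have : (∑ i ∈ C, proj i) x = ∑ i ∈ C, proj i x := by
      induction C using Finset.induction_on with
      | empty => simp
      | insert a s ha ih => simp [Finset.sum_insert ha, ih]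
    simp [this, proj]
  have h := mem_convexHull_sep_eq_zero hmem (Λ₁ ∪ Λ₂) ?_ ?_
  · obtain ⟨a, ⟨S, hS, rfl⟩, ha⟩ := convexHull_nonempty_iff.1 ⟨_, h⟩
    refine ⟨S, hS, fun i hi => ?_, fun C hC hcl hcard => ?_⟩
    · by_contra hiH
      have := ha (proj i) (Or.inl ⟨i, hiH, rfl⟩)
      simp [proj, hi] at this
    · have := ha _ (Or.inr ⟨C, hC, hcl, hcard, rfl⟩)
      rw [happ] at this
      by_contra! hno
      rw [Finset.sum_eq_zero fun i hi => by simp [hno i hi]] at this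
      norm_num at this
  · rintro l (⟨i, -, rfl⟩ | ⟨C, -, hcl, -, rfl⟩) _ ⟨S, hS, rfl⟩
    · exact Set.indicator_nonneg (fun _ _ => zero_le_one) i
    · rw [happ, sub_nonneg]
      have : ∑ i ∈ C, S.indicator (fun _ => (1 : ℝ)) i = ((C.filter (· ∈ S)).card : ℝ) := by
        simp [Set.indicator_apply]
      rw [this]
      norm_cast
      rw [Finset.card_le_one]
      intro a ha b hb
      rw [Finset.mem_filter] at ha hb
      by_contra hab
      exact hS ha.2 hb.2 hab (hcl ha.1 hb.1 hab)
  · rintro l (⟨i, hi, rfl⟩ | ⟨C, hC, -, hcard, rfl⟩)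
    · simp [proj, hi]
    · rw [happ, Finset.sum_congr rfl fun i hi =>
        Set.indicator_of_mem (Finset.mem_coe.2 (hC hi)) _]
      simp [hcard, hk.ne']

/-- If the uniform weighting `1 / k` of every `H` without larger cliques lies in the stable set
polytope, then repeatedly removing a stable set that meets all maximum cliques colors `H` with `k`
colors. -/
theorem exists_coloring_of_indicator_mem {V : Type*} [Fintype V] {G : SimpleGraph V}
    (hG : ∀ (H : Finset V) (k : ℕ), 0 < k →
      (∀ C ⊆ H, G.IsClique (C : Set V) → C.card ≤ k) →
      (H : Set V).indicator (fun _ => (k : ℝ)⁻¹) ∈ stableSetPolytope G) (k : ℕ) :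
    ∀ H : Finset V, (∀ C ⊆ H, G.IsClique (C : Set V) → C.card ≤ k) →
      ∃ f : V → ℕ, (∀ i ∈ H, f i < k) ∧ ∀ i ∈ H, ∀ j ∈ H, G.Adj i j → f i ≠ f j := by
  classical
  induction k with
  | zero =>
    intro H hH
    have : ∀ i, i ∉ H := fun i hi => by
      have := hH {i} (by simpa using hi) (by simp)
      simp at this
    exact ⟨0, fun i hi => absurd hi (this i), fun i hi => absurd hi (this i)⟩
  | succ k ih =>
    intro H hH
    obtain ⟨S, hS, hSH, hhit⟩ := exists_isIndepSet_hitting k.succ_pos (hG H _ k.succ_pos hH)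
    obtain ⟨f, hf, hadj⟩ := ih (H.filter (· ∉ S)) fun C hC hcl => by
      have hCH : C ⊆ H := hC.trans (Finset.filter_subset _ _)
      by_contra! hlt
      obtain ⟨i, hi, hiS⟩ := hhit C hCH hcl (le_antisymm (hH C hCH hcl) hlt)
      exact (Finset.mem_filter.1 (hC hi)).2 hiS
    refine ⟨fun i => if i ∈ S then k else f i, fun i hi => ?_, fun i hi j hj hij => ?_⟩
    · by_cases hiS : i ∈ S
      · simp [hiS]
      · simpa [hiS] using (hf i (by simp [hi, hiS])).trans k.lt_succ_self
    · by_cases hiS : i ∈ S <;> by_cases hjS : j ∈ S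
      · exact absurd hij (hS hiS hjS hij.ne)
      · simpa [hiS, hjS] using (hf j (by simp [hj, hjS])).ne'
      · simpa [hiS, hjS] using (hf i (by simp [hi, hiS])).ne
      · simpa [hiS, hjS] using hadj i (by simp [hi, hiS]) j (by simp [hj, hjS]) hij

theorem isPerfectGraph_of_indicator_mem {V : Type*} [Fintype V] {G : SimpleGraph V}
    (hG : ∀ (H : Finset V) (k : ℕ), 0 < k →
      (∀ C ⊆ H, G.IsClique (C : Set V) → C.card ≤ k) →
      (H : Set V).indicator (fun _ => (k : ℝ)⁻¹) ∈ stableSetPolytope G) : IsPerfectGraph G := by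
  classical
  intro s
  refine le_antisymm ?_ SimpleGraph.cliqueNum_le_chromaticNumber
  obtain ⟨f, hf, hadj⟩ := exists_coloring_of_indicator_mem hG (G.induce s).cliqueNum
    s.toFinset fun C hC hcl => by
      have hcl' : (G.induce s).IsClique (C.subtype (· ∈ s) : Finset s) := by
        intro a ha b hb hab
        exact hcl (by simpa using ha) (by simpa using hb) (fun h => hab (Subtype.ext h))
      have := SimpleGraph.IsClique.card_le_cliqueNum (tc := hcl')
      rwa [Finset.card_subtype, Finset.filter_true_of_mem fun i hi => by
        simpa using hC hi] at this
  rw [SimpleGraph.chromaticNumber_le_iff_colorable]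
  refine ⟨SimpleGraph.Coloring.mk (fun i : s => ⟨f i, hf i (by simp)⟩) fun {i j} hij h => ?_⟩
  exact hadj i (by simp) j (by simp) hij (by simpa using h)

/-! ### Facet slacks of a 2-level polytope -/

theorem IsPolytope.finite_extremePoints {E : Type*} [AddCommGroup E] [Module ℝ E] {P : Set E}
    (hP : IsPolytope P) : (P.extremePoints ℝ).Finite := by
  obtain ⟨S, hS, rfl⟩ := hP
  exact hS.subset extremePoints_convexHull_subset

theorem IsPolytope.convexHull_extremePoints {E : Type*} [NormedAddCommGroup E] [NormedSpace ℝ E]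
    {P : Set E} (hP : IsPolytope P) : convexHull ℝ (P.extremePoints ℝ) = P := by
  have hfin := hP.finite_extremePoints
  obtain ⟨S, hS, rfl⟩ := hP
  rw [← (hfin.isCompact_convexHull ℝ).isClosed.closure_eq]
  exact closure_convexHull_extremePoints (hS.isCompact_convexHull ℝ) (convex_convexHull ℝ S)

theorem IsPolytope.vectorSpan_extremePoints {E : Type*} [NormedAddCommGroup E] [NormedSpace ℝ E]
    {P : Set E} (hP : IsPolytope P) : vectorSpan ℝ (P.extremePoints ℝ) = vectorSpan ℝ P := by
  conv_rhs => rw [← hP.convexHull_extremePoints]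
  rw [← direction_affineSpan, ← direction_affineSpan, affineSpan_convexHull]

/-- An affine function that is nonnegative on `P`, vanishes on `P` exactly along a facet, and takes
only the values `0` and `1` at the vertices: the slack of a facet-defining inequality of a 2-level
polytope, scaled so that the parallel hyperplane is at level `1`. -/
structure IsFacetSlack {E : Type*} [AddCommGroup E] [Module ℝ E] (P : Set E) (φ : E →ᵃ[ℝ] ℝ) :
    Prop where
  nonneg : ∀ x ∈ P, 0 ≤ φ x
  level : ∀ w ∈ P.extremePoints ℝ, φ w = 0 ∨ φ w = 1
  isFacet : IsFacet P (P ∩ {x | φ x = 0})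

theorem IsTwoLevel.exists_isFacetSlack {E : Type*} [NormedAddCommGroup E] [NormedSpace ℝ E]
    {P : Set E} (hP : IsTwoLevel P) {g : Dual ℝ E} {c : ℝ} (hg : IsFacetDefining P g c) :
    ∃ φ : E →ᵃ[ℝ] ℝ, IsFacetSlack P φ ∧ P ∩ {x | g x = c} = P ∩ {x | φ x = 0} ∧
      ∀ x, c < g x → φ x < 0 := by
  obtain ⟨c', hc'⟩ := hP.2 g c hg
  obtain ⟨w, hw, hwc⟩ : ∃ w ∈ P.extremePoints ℝ, g w ≠ c := by
    by_contra! hall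
    have hsub : P ⊆ {x | g x = c} := by
      rw [← hP.1.convexHull_extremePoints]
      exact convexHull_min hall (convex_hyperplane g.isLinear c)
    have := hg.2.2
    rw [inter_eq_left.2 hsub] at this
    omega
  have hlt : 0 < c - c' := by
    rw [← hc' w hw hwc]
    exact sub_pos.2 ((hg.1 w hw.1).lt_of_ne hwc)
  let φ : E →ᵃ[ℝ] ℝ := (c - c')⁻¹ • (AffineMap.const ℝ E c - g.toAffineMap)
  have hφ : ∀ x, φ x = (c - c')⁻¹ * (c - g x) := fun x => rfl
  have hzero : ∀ x, φ x = 0 ↔ g x = c := fun x => by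
    rw [hφ, mul_eq_zero, inv_eq_zero]
    exact ⟨fun h => by linarith [h.resolve_left hlt.ne'], fun h => Or.inr (by linarith)⟩
  have hface : P ∩ {x | g x = c} = P ∩ {x | φ x = 0} := by
    ext x
    simp [hzero]
  refine ⟨φ, ⟨fun x hx => ?_, fun x hx => ?_, ⟨g, c, hg, hface.symm⟩⟩, hface, fun x hx => ?_⟩
  · exact mul_nonneg (inv_pos.2 hlt).le (sub_nonneg.2 (hg.1 x hx))
  · by_cases h : g x = c
    · exact Or.inl ((hzero x).2 h)
    · right
      rw [hφ, hc' x hx h, inv_mul_cancel₀ hlt.ne']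
  · exact mul_neg_of_pos_of_neg (inv_pos.2 hlt) (sub_neg.2 hx)

/-- Within its affine hull, a 2-level polytope is cut out by its facet slacks. -/
theorem IsTwoLevel.mem_of_isFacetSlack_nonneg {E : Type*} [NormedAddCommGroup E] [NormedSpace ℝ E]
    [FiniteDimensional ℝ E] {P : Set E} (hP : IsTwoLevel P) {v u : E}
    (hv : v ∈ P.extremePoints ℝ) (hu : u ∈ vectorSpan ℝ P)
    (h : ∀ φ, IsFacetSlack P φ → 0 ≤ φ (v + u)) : v + u ∈ P := by
  by_contra hnot
  rw [← hP.1.vectorSpan_extremePoints] at hu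
  obtain ⟨g, c, hg, hlt⟩ := exists_isFacetDefining_of_notMem hP.1.finite_extremePoints hv hu
    (by rwa [hP.1.convexHull_extremePoints])
  rw [hP.1.convexHull_extremePoints] at hg
  obtain ⟨φ, hφ, -, hneg⟩ := hP.exists_isFacetSlack hg
  exact absurd (h φ hφ) (not_le.2 (hneg _ hlt))

/-- Two facet slacks of the same facet agree at the vertices, hence on the affine hull. -/
theorem IsFacetSlack.linear_eq_of_face_eq {E : Type*} [NormedAddCommGroup E] [NormedSpace ℝ E]
    {P : Set E} (hP : IsTwoLevel P) {φ ψ : E →ᵃ[ℝ] ℝ} (hφ : IsFacetSlack P φ)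
    (hψ : IsFacetSlack P ψ) (h : P ∩ {x | φ x = 0} = P ∩ {x | ψ x = 0}) {u : E}
    (hu : u ∈ vectorSpan ℝ P) : φ.linear u = ψ.linear u := by
  have hV : ∀ w ∈ P.extremePoints ℝ, φ w = ψ w := fun w hw => by
    have hiff : φ w = 0 ↔ ψ w = 0 := by
      have := Set.ext_iff.1 h w
      simpa [hw.1] using this
    rcases hφ.level w hw with h0 | h1
    · rw [h0, hiff.1 h0]
    · rcases hψ.level w hw with h0' | h1'
      · rw [h0', hiff.2 h0']
      · rw [h1, h1']
  have hle : vectorSpan ℝ P ≤ LinearMap.eqLocus φ.linear ψ.linear := by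
    rw [← hP.1.vectorSpan_extremePoints, vectorSpan_def, Submodule.span_le]
    rintro _ ⟨a, ha, b, hb, rfl⟩
    simp only [SetLike.mem_coe, LinearMap.mem_eqLocus, AffineMap.linearMap_vsub, hV a ha, hV b hb]
  exact hle hu

/-- In a fixed direction of the affine hull, all facet slacks vary at a bounded rate, because their
vertex values are bounded. -/
theorem IsTwoLevel.exists_bound_linear {E : Type*} [NormedAddCommGroup E] [NormedSpace ℝ E]
    {P : Set E} (hP : IsTwoLevel P) {u : E} (hu : u ∈ vectorSpan ℝ P) :
    ∃ B : ℝ, ∀ φ, IsFacetSlack P φ → |φ.linear u| ≤ B := by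
  rw [← hP.1.vectorSpan_extremePoints, vectorSpan_def] at hu
  induction hu using Submodule.span_induction with
  | mem x hx =>
    obtain ⟨a, ha, b, hb, rfl⟩ := hx
    refine ⟨1, fun φ hφ => ?_⟩
    simp only [AffineMap.linearMap_vsub]
    rcases hφ.level a ha with h | h <;> rcases hφ.level b hb with h' | h' <;> simp [h, h']
  | zero => exact ⟨0, fun φ _ => by simp⟩
  | add x y _ _ hx hy =>
    obtain ⟨B, hB⟩ := hx
    obtain ⟨C, hC⟩ := hy
    refine ⟨B + C, fun φ hφ => ?_⟩
    rw [map_add]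
    exact (abs_add_le _ _).trans (add_le_add (hB φ hφ) (hC φ hφ))
  | smul a x _ hx =>
    obtain ⟨B, hB⟩ := hx
    refine ⟨|a| * B, fun φ hφ => ?_⟩
    rw [map_smul, smul_eq_mul, abs_mul]
    exact mul_le_mul_of_nonneg_left (hB φ hφ) (abs_nonneg a)

theorem AffineMap.apply_add_eq {E : Type*} [AddCommGroup E] [Module ℝ E] (φ : E →ᵃ[ℝ] ℝ)
    (v u : E) : φ (v + u) = φ v + φ.linear u := by
  rw [add_comm v u, add_comm (φ v)]
  exact φ.map_vadd v u

/-- The facet slacks vanishing at a vertex cut out the tangent cone at that vertex. -/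
theorem IsTwoLevel.exists_pos_add_smul_mem {E : Type*} [NormedAddCommGroup E] [NormedSpace ℝ E]
    [FiniteDimensional ℝ E] {P : Set E} (hP : IsTwoLevel P) {v u : E}
    (hv : v ∈ P.extremePoints ℝ) (hu : u ∈ vectorSpan ℝ P)
    (h : ∀ φ, IsFacetSlack P φ → φ v = 0 → 0 ≤ φ.linear u) : ∃ ε : ℝ, 0 < ε ∧ v + ε • u ∈ P := by
  obtain ⟨B, hB⟩ := hP.exists_bound_linear hu
  have hpos : 0 < (1 + |B|)⁻¹ := by positivity
  refine ⟨_, hpos, hP.mem_of_isFacetSlack_nonneg hv (Submodule.smul_mem _ _ hu) fun φ hφ => ?_⟩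
  rw [φ.apply_add_eq, map_smul, smul_eq_mul]
  rcases hφ.level v hv with h0 | h1
  · rw [h0, zero_add]
    exact mul_nonneg hpos.le (h φ hφ h0)
  · have h2 : -(1 + |B|) ≤ φ.linear u := by
      have := (abs_le.1 (hB φ hφ)).1
      have := le_abs_self B
      linarith
    have h3 := mul_le_mul_of_nonneg_left h2 hpos.le
    rw [mul_neg, inv_mul_cancel₀ (by positivity)] at h3
    linarith

/-! ### Coordinates at a simple vertex -/

/-- The facets through a vertex `v`, listed with one slack each. -/
theorem IsSimpleVertex.exists_slacks {E : Type*} [NormedAddCommGroup E] [NormedSpace ℝ E]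
    {P : Set E} (hP : IsTwoLevel P) {v : E} (hv : IsSimpleVertex P v) :
    ∃ φ : Fin (polyDim P) → (E →ᵃ[ℝ] ℝ), (∀ i, IsFacetSlack P (φ i) ∧ φ i v = 0) ∧
      ∀ ψ, IsFacetSlack P ψ → ψ v = 0 → ∃ i, ∀ u ∈ vectorSpan ℝ P,
        ψ.linear u = (φ i).linear u := by
  have hfin : {F : Set E | IsFacet P F ∧ v ∈ F}.Finite := finite_of_encard_eq_coe hv.2
  have hcard : Nat.card {F : Set E | IsFacet P F ∧ v ∈ F} = polyDim P := by
    rw [Nat.card_coe_set_eq, Set.ncard, hv.2, ENat.toNat_natCast]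
  have := hfin.to_subtype
  let e := Finite.equivFinOfCardEq hcard
  have hex : ∀ F : {F : Set E | IsFacet P F ∧ v ∈ F},
      ∃ φ : E →ᵃ[ℝ] ℝ, IsFacetSlack P φ ∧ F = P ∩ {x | φ x = 0} := by
    rintro ⟨F, ⟨g, c, hg, rfl⟩, hF⟩
    obtain ⟨φ, hφ, heq, -⟩ := hP.exists_isFacetSlack hg
    exact ⟨φ, hφ, heq⟩
  choose φ hφ hF using hex
  refine ⟨fun i => φ (e.symm i), fun i => ⟨hφ _, ?_⟩, fun ψ hψ hψv => ?_⟩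
  · have := (e.symm i).2.2
    rw [hF] at this
    exact this.2
  · refine ⟨e ⟨P ∩ {x | ψ x = 0}, hψ.isFacet, hv.1.1, hψv⟩, fun u hu => ?_⟩
    refine hψ.linear_eq_of_face_eq hP (hφ _) ?_ hu
    rw [← hF, Equiv.symm_apply_apply]

/-- At a simple vertex `v`, the slacks `φ i` of the facets through `v` are linear coordinates for
the affine hull, with dual basis `b`; the neighbours of `v` are the vertices `v + b i`. -/
theorem IsSimpleVertex.exists_dual_basis {E : Type*} [NormedAddCommGroup E] [NormedSpace ℝ E]
    [FiniteDimensional ℝ E] {P : Set E} (hP : IsTwoLevel P) {v : E} (hv : IsSimpleVertex P v) :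
    ∃ (φ : Fin (polyDim P) → (E →ᵃ[ℝ] ℝ)) (b : Fin (polyDim P) → E),
      (∀ i, IsFacetSlack P (φ i) ∧ φ i v = 0) ∧
      (∀ ψ, IsFacetSlack P ψ → ψ v = 0 → ∃ i, ∀ u ∈ vectorSpan ℝ P,
        ψ.linear u = (φ i).linear u) ∧
      (∀ i, b i ∈ vectorSpan ℝ P) ∧
      (∀ i (c : Fin (polyDim P) → ℝ), (φ i).linear (∑ j, c j • b j) = c i) ∧
      (∀ u ∈ vectorSpan ℝ P, u = ∑ j, (φ j).linear u • b j) ∧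
      ∀ i, v + b i ∈ P.extremePoints ℝ := by
  classical
  obtain ⟨φ, hφ, hall⟩ := hv.exists_slacks hP
  let Φ : vectorSpan ℝ P →ₗ[ℝ] (Fin (polyDim P) → ℝ) :=
    LinearMap.pi fun i => (φ i).linear ∘ₗ (vectorSpan ℝ P).subtype
  have hΦ : ∀ u i, Φ u i = (φ i).linear u := fun u i => rfl
  have hcone : ∀ u ∈ vectorSpan ℝ P, (∀ i, 0 ≤ (φ i).linear u) →
      ∃ ε : ℝ, 0 < ε ∧ v + ε • u ∈ P := fun u hu h =>
    hP.exists_pos_add_smul_mem hv.1 hu fun ψ hψ hψv => by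
      obtain ⟨i, hi⟩ := hall ψ hψ hψv
      rw [hi u hu]
      exact h i
  -- A direction killed by all `φ i` could be followed both ways inside `P`, but `v` is extreme.
  have hinj : Function.Injective Φ := by
    rw [injective_iff_map_eq_zero]
    rintro ⟨u, hu⟩ h0
    have hu0 : ∀ i, (φ i).linear u = 0 := fun i => by rw [← hΦ ⟨u, hu⟩ i, h0]; rfl
    obtain ⟨ε, hε, h1⟩ := hcone u hu fun i => (hu0 i).ge
    obtain ⟨δ, hδ, h2⟩ := hcone (-u) (neg_mem hu) fun i => by simp [hu0]
    have hseg : v ∈ openSegment ℝ (v + ε • u) (v + δ • -u) := by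
      refine ⟨δ / (ε + δ), ε / (ε + δ), by positivity, by positivity, by field_simp; ring, ?_⟩
      match_scalars <;> field_simp <;> ring
    have := (mem_extremePoints_iff_left.1 hv.1).2 _ h1 _ h2 hseg
    have : u = 0 := by simpa [hε.ne'] using this
    simp [this]
  let L := LinearMap.linearEquivOfInjective Φ hinj (finrank_fin_fun ℝ).symm
  have hL : ∀ c i, (φ i).linear (L.symm c : E) = c i := fun c i => by
    rw [← hΦ]
    exact congrFun (L.apply_symm_apply c) i
  have hsum : ∀ c : Fin (polyDim P) → ℝ,
      ∑ j, c j • (L.symm (Pi.single j 1) : E) = (L.symm c : E) := fun c => by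
    have h1 : c = ∑ j, c j • (Pi.single j (1 : ℝ) : Fin (polyDim P) → ℝ) := by
      ext k; simp [Finset.sum_apply, Pi.single_apply]
    conv_rhs => rw [h1, map_sum]
    simp
  refine ⟨φ, fun i => L.symm (Pi.single i 1), hφ, hall, fun i => (L.symm _).2, fun i c => ?_,
    fun u hu => ?_, fun i => ?_⟩
  · rw [hsum, hL]
  · have h2 : (L.symm (Φ ⟨u, hu⟩) : E) = u := congrArg Subtype.val (L.symm_apply_apply ⟨u, hu⟩)
    rw [← hsum] at h2
    exact h2.symm
  · -- A vertex on the edge in direction `b i` other than `v` has coordinates `Pi.single i 1`.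
    set b := L.symm (Pi.single i 1) with hb
    obtain ⟨ε, hε, hmem⟩ := hcone b b.2 fun j => by
      rw [hb, hL]
      exact (Pi.single_nonneg.2 zero_le_one : (0 : Fin (polyDim P) → ℝ) ≤ Pi.single i 1) j
    have happ : ∀ j, φ j (v + ε • (b : E)) = ε * (Pi.single i 1 : Fin (polyDim P) → ℝ) j :=
      fun j => by
        rw [(φ j).apply_add_eq, (hφ j).2, zero_add, map_smul, smul_eq_mul, hb, hL]
    replace hmem := hP.1.convexHull_extremePoints.superset hmem
    have hface := mem_convexHull_sep_eq_zero hmem {l | ∃ j ≠ i, l = φ j}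
      (by rintro _ ⟨j, -, rfl⟩ a ha; exact (hφ j).1.nonneg a ha.1)
      (by rintro _ ⟨j, hj, rfl⟩; simp [happ, hj])
    obtain ⟨w, ⟨hw, hwz⟩, hwi⟩ : ∃ w ∈ {a ∈ P.extremePoints ℝ | ∀ l ∈ {l | ∃ j ≠ i, l = φ j},
        l a = 0}, φ i w = 1 := by
      by_contra! hno
      have hsub : {a ∈ P.extremePoints ℝ | ∀ l ∈ {l | ∃ j ≠ i, l = φ j}, l a = 0} ⊆
          φ i ⁻¹' {0} := fun a ha => ((hφ i).1.level a ha.1).resolve_right (hno a ha)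
      have h0 : φ i (v + ε • (b : E)) = 0 :=
        convexHull_min hsub ((convex_singleton 0).affine_preimage (φ i)) hface
      simp [happ, hε.ne'] at h0
    have hwv : w - v ∈ vectorSpan ℝ P := vsub_mem_vectorSpan ℝ hw.1 hv.1.1
    have hwb : (⟨w - v, hwv⟩ : vectorSpan ℝ P) = b := by
      apply hinj
      ext j
      rw [hΦ, hΦ, hb, hL]
      have : φ j w = (φ j).linear (w - v) := by
        rw [← zero_add ((φ j).linear _), ← (hφ j).2, ← (φ j).apply_add_eq, add_sub_cancel]
      rw [← this]
      rcases eq_or_ne j i with rfl | hji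
      · simp [hwi]
      · simp [hji, hwz (φ j) ⟨j, hji, rfl⟩]
    change v + (b : E) ∈ P.extremePoints ℝ
    rwa [← hwb, add_sub_cancel]

/-! ### The stable set polytope at a simple vertex -/

/-- The conflict graph of a polytope `P` at a vertex `v` with neighbours `v + b i`: indices `i ≠ j`
are joined when `v + b i + b j` leaves `P`. -/
def conflictGraph {E ι : Type*} [AddCommGroup E] (P : Set E) (v : E) (b : ι → E) :
    SimpleGraph ι where
  Adj i j := i ≠ j ∧ v + (b i + b j) ∉ P
  symm := ⟨fun i j h => ⟨h.1.symm, by rw [add_comm (b j)]; exact h.2⟩⟩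
  loopless := ⟨fun _ h => h.1 rfl⟩

/-- In the facet coordinates at a simple vertex, `P` becomes the stable set polytope of its conflict
graph, and the facet description passes to that polytope the uniform weightings needed for
perfection. -/
theorem IsSimpleVertex.exists_isPerfectGraph_affinelyIsomorphic {E : Type*}
    [NormedAddCommGroup E] [NormedSpace ℝ E] [FiniteDimensional ℝ E] {P : Set E}
    (hP : IsTwoLevel P) {v : E} (hv : IsSimpleVertex P v) :
    ∃ G : SimpleGraph (Fin (polyDim P)),
      IsPerfectGraph G ∧ AffinelyIsomorphic P (stableSetPolytope G) := by
  classical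
  obtain ⟨φ, b, hφ, hall, hb, hdual, hexp, hbV⟩ := hv.exists_dual_basis hP
  let x : (Fin (polyDim P) → ℝ) → E := fun c => v + ∑ j, c j • b j
  have hsumW : ∀ c : Fin (polyDim P) → ℝ, ∑ j, c j • b j ∈ vectorSpan ℝ P := fun c =>
    Submodule.sum_mem _ fun j _ => Submodule.smul_mem _ _ (hb j)
  have hφx : ∀ i c, φ i (x c) = c i := fun i c => by
    rw [(φ i).apply_add_eq, (hφ i).2, hdual, zero_add]
  have hψx : ∀ (ψ : E →ᵃ[ℝ] ℝ) c, ψ (x c) = ψ v + ∑ j, c j * ψ.linear (b j) := fun ψ c => by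
    rw [ψ.apply_add_eq]; simp
  -- The row of `ψ`: the set of `i` with `ψ.linear (b i) = -1`.
  have hrow : ∀ ψ, IsFacetSlack P ψ → ψ v = 1 → ∀ i,
      ψ.linear (b i) = 0 ∨ ψ.linear (b i) = -1 := fun ψ hψ hψv i => by
    have h1 := hψ.level _ (hbV i)
    rw [ψ.apply_add_eq, hψv] at h1
    rcases h1 with h | h
    · right; linarith
    · left; linarith
  have hxP : ∀ c : Fin (polyDim P) → ℝ, (∀ i, 0 ≤ c i) → (∀ ψ, IsFacetSlack P ψ → ψ v = 1 →
      ∑ j ∈ Finset.univ.filter (fun j => ψ.linear (b j) = -1), c j ≤ 1) → x c ∈ P := by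
    intro c hc hle
    refine hP.mem_of_isFacetSlack_nonneg hv.1 (hsumW c) fun ψ hψ => ?_
    rcases hψ.level v hv.1 with h0 | h1
    · obtain ⟨i, hi⟩ := hall ψ hψ h0
      rw [ψ.apply_add_eq, h0, zero_add, hi _ (hsumW c), hdual]
      exact hc i
    · have h2 := hle ψ hψ h1
      have h3 : ψ (x c) = 1 + ∑ j, c j * ψ.linear (b j) := by rw [hψx, h1]
      have h4 : ∑ j, c j * ψ.linear (b j) =
          -∑ j ∈ Finset.univ.filter (fun j => ψ.linear (b j) = -1), c j := by
        rw [Finset.sum_filter, ← Finset.sum_neg_distrib]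
        refine Finset.sum_congr rfl fun j _ => ?_
        rcases hrow ψ hψ h1 j with h | h <;> simp [h]
      change 0 ≤ ψ (x c)
      linarith
  set G := conflictGraph P v b
  -- Two members of a row conflict, since `ψ (v + b i + b j) = 1 - 1 - 1`.
  have hclique : ∀ ψ, IsFacetSlack P ψ → ψ v = 1 → ∀ i j, i ≠ j → ψ.linear (b i) = -1 →
      ψ.linear (b j) = -1 → G.Adj i j := by
    intro ψ hψ hψv i j hij hi hj
    refine ⟨hij, fun hmem => ?_⟩
    have := hψ.nonneg _ hmem
    rw [ψ.apply_add_eq, map_add, hψv, hi, hj] at this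
    norm_num at this
  have hadj : ∀ i j, G.Adj i j → ∃ ψ, IsFacetSlack P ψ ∧ ψ v = 1 ∧ ψ.linear (b i) = -1 ∧
      ψ.linear (b j) = -1 := by
    rintro i j ⟨-, hnot⟩
    by_contra! hno
    refine hnot (hP.mem_of_isFacetSlack_nonneg hv.1 (add_mem (hb i) (hb j)) fun ψ hψ => ?_)
    rw [ψ.apply_add_eq, map_add]
    rcases hψ.level v hv.1 with h0 | h1
    · have h2 := hψ.nonneg _ (hbV i).1
      have h3 := hψ.nonneg _ (hbV j).1
      rw [ψ.apply_add_eq, h0] at h2 h3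
      linarith
    · rcases hrow ψ hψ h1 i with hi | hi
      · rcases hrow ψ hψ h1 j with hj | hj <;> rw [h1, hi, hj] <;> norm_num
      · rcases hrow ψ hψ h1 j with hj | hj
        · rw [h1, hi, hj]; norm_num
        · exact absurd hj (hno ψ hψ h1 hi)
  let y : E →ᵃ[ℝ] (Fin (polyDim P) → ℝ) := AffineMap.pi φ
  have hy : ∀ z i, y z i = φ i z := fun z i => rfl
  have hyx : ∀ c, y (x c) = c := fun c => funext fun i => hφx i c
  have hxy : ∀ z ∈ P, x (y z) = z := fun z hz => by
    have h1 := hexp (z - v) (vsub_mem_vectorSpan ℝ hz hv.1.1)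
    have h2 : ∀ i, φ i z = (φ i).linear (z - v) := fun i => by
      rw [← zero_add ((φ i).linear _), ← (hφ i).2, ← (φ i).apply_add_eq, add_sub_cancel]
    simp only [x, hy, h2]
    rw [← h1, add_sub_cancel]
  have himage : y '' P = stableSetPolytope G := by
    apply Subset.antisymm
    · refine (image_mono hP.1.convexHull_extremePoints.superset).trans ?_
      rw [y.image_convexHull]
      refine convexHull_mono ?_
      rintro _ ⟨w, hw, rfl⟩
      have hyw : y w = {i | φ i w = 1}.indicator (fun _ => (1 : ℝ)) := by
        ext i
        rw [hy, indicator_apply]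
        rcases (hφ i).1.level w hw with h | h <;> simp [h]
      refine ⟨{i | φ i w = 1}, fun i hi j hj hij hadj' => ?_, hyw⟩
      obtain ⟨ψ, hψ, hψv, hψi, hψj⟩ := hadj i j hadj'
      -- `ψ w ≤ 1 - 1 - 1`, the remaining terms being nonpositive.
      have h1 : ∑ k ∈ {i, j}, -(y w k * ψ.linear (b k)) ≤ ∑ k, -(y w k * ψ.linear (b k)) := by
        refine Finset.sum_le_sum_of_subset_of_nonneg (Finset.subset_univ _) fun k _ _ => ?_
        refine neg_nonneg.2 (mul_nonpos_of_nonneg_of_nonpos ((hφ k).1.nonneg w hw.1) ?_)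
        rcases hrow ψ hψ hψv k with h | h <;> rw [h] <;> norm_num
      have h2 := hψ.nonneg w hw.1
      rw [← hxy w hw.1, hψx, hψv] at h2
      rw [Finset.sum_pair hij, hψi, hψj, hy, hy, show φ i w = 1 from hi, show φ j w = 1 from hj,
        Finset.sum_neg_distrib] at h1
      linarith
    · have hconv : Convex ℝ P := hP.1.convexHull_extremePoints ▸ convex_convexHull ℝ _
      refine convexHull_min ?_ (hconv.affine_image y)
      rintro _ ⟨S, hS, rfl⟩
      refine ⟨_, hxP _ (fun i => indicator_nonneg (fun _ _ => zero_le_one) i)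
        fun ψ hψ hψv => ?_, hyx _⟩
      have h1 : ∀ C : Finset (Fin (polyDim P)), ∑ i ∈ C, S.indicator (fun _ => (1 : ℝ)) i =
          ((C.filter (· ∈ S)).card : ℝ) := fun C => by simp [indicator_apply]
      rw [h1]
      rw [Nat.cast_le_one, Finset.card_le_one]
      intro i hi j hj
      simp only [Finset.mem_filter, Finset.mem_univ, true_and] at hi hj
      by_contra hij
      exact hS hi.2 hj.2 hij (hclique ψ hψ hψv i j hij hi.1 hj.1)
  refine ⟨G, isPerfectGraph_of_indicator_mem fun H k hk hH => ?_, y, ?_⟩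
  · rw [← himage]
    refine ⟨_, hxP _ (fun i => indicator_nonneg (fun _ _ => by positivity) i)
      fun ψ hψ hψv => ?_, hyx _⟩
    set C := Finset.univ.filter (fun j => ψ.linear (b j) = -1) with hC
    have h1 : ∑ i ∈ C, (H : Set (Fin (polyDim P))).indicator (fun _ => (k : ℝ)⁻¹) i =
        (C.filter (· ∈ H)).card * (k : ℝ)⁻¹ := by
      simp [indicator_apply, Finset.filter_mem_eq_inter]
    have h2 : (C.filter (· ∈ H)).card ≤ k := by
      refine hH _ (fun i hi => (Finset.mem_filter.1 hi).2) fun i hi j hj hij => ?_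
      simp only [hC, Finset.coe_filter, Finset.mem_filter, Finset.mem_univ, true_and,
        mem_ofPred_eq] at hi hj
      exact hclique ψ hψ hψv i j hij hi.1 hj.1
    rw [h1, ← div_eq_mul_inv, div_le_one (by exact_mod_cast hk)]
    exact_mod_cast h2
  · rw [← himage]
    refine InjOn.bijOn_image fun a ha c hc hac => ?_
    rw [← hxy a ha, ← hxy c hc, hac]

theorem mainTheorem2 (n : ℕ) (P : Set (Fin n → ℝ)) (hP : IsTwoLevel P)
    (hv : ∃ v : Fin n → ℝ, IsSimpleVertex P v) :
    ∃ (m : ℕ) (G : SimpleGraph (Fin m)),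
      IsPerfectGraph G ∧ AffinelyIsomorphic P (stableSetPolytope G) := by
  obtain ⟨v, hv⟩ := hv
  exact ⟨_, hv.exists_isPerfectGraph_affinelyIsomorphic hP⟩
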